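/- Let $(M,g_M)$ and $(N,g_N)$ be smooth (Hausdorff, finite-dimensional, boundaryless) Riemannian manifolds with Levi-Civita connections $\nabla^M,\nabla^N$, and let $(\phi,\xi,\eta)$ be a smooth almost contact metric structure on $(M,g_M)$, i.e. a $(1,1)$-tensor field $\phi$, a vector field $\xi$ and a $1$-form $\eta$ with $\phi\xi=0$, $\eta\circ\phi=0$, $\eta(\xi)=1$, $\phi^2=-I+\eta\otimes\xi$ and $g_M(\phi X,\phi Y)=g_M(X,Y)-\eta(X)\eta(Y)$. Assume that it is Sasakian, in the sign convention $(\nabla^M_X\phi)Y=-g_M(X,Y)\xi+\eta(Y)X$ and $\nabla^M_X\xi=\phi X$. Let $\pi:M\to N$ be a conformal anti-invariant $\xi^\perp$-submersion with dilation $\lambda:M\to(0,\infty)$. That is, $\pi$ is smooth with surjective differential $\pi_*$ at every point, $\lambda^2 g_M(X,Y)=g_N(\pi_*X,\pi_*Y)$ for all horizontal vectors $X,Y\in(\ker\pi_*)^\perp$, the vector field $\xi$ is horizontal, and $\phi(\ker\pi_*)\subset(\ker\pi_*)^\perp$. Assume moreover that $\ker\pi_*\neq 0$ at every point and that $(\ker\pi_*)^\perp=\phi(\ker\pi_*)\oplus\langle\xi\rangle$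 at every point. For a vector $X$ and a vector field $Y$ on $M$ let $(\nabla\pi_*)(X,Y)=\nabla^\pi_X(\pi_*Y)-\pi_*(\nabla^M_XY)$ be the second fundamental form of $\pi$, where $\nabla^\pi$ is the connection on $\pi^{-1}TN$ obtained by pulling back $\nabla^N$. Call $\pi$ a $(\phi\ker\pi_*,\mu)$-totally geodesic map, with $\mu=\langle\xi\rangle$, if $(\nabla\pi_*)(\phi U,\xi)=0$ for all vertical $U$ (i.e. $U\in\ker\pi_*$), and call $\pi$ horizontally homothetic if the gradient of $\lambda$ is vertical at every point. Then $\pi$ is a $(\phi\ker\pi_*,\mu)$-totally geodesic map if and only if $\pi$ is horizontally homothetic. -/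

import Mathlib

open Bundle Manifold VectorField FiberBundle
open scoped ContDiff InnerProductSpace

noncomputable section

namespace XiPerp

/-! ### Riemannian geometry: Levi-Civita derivative, gradient -/

section Riemannian

variable {E : Type*} [NormedAddCommGroup E] [NormedSpace ℝ E]
  {H : Type*} [TopologicalSpace H] (I : ModelWithCorners ℝ E H)
  {M : Type*} [TopologicalSpace M] [ChartedSpace H M]

instance instFiniteDimensionalTangentSpace [FiniteDimensional ℝ E] (x : M) :
    FiniteDimensional ℝ (TangentSpace I x) :=
  inferInstanceAs (FiniteDimensional ℝ E)

/-- A smooth vector field. -/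
def IsSmoothVectorField [IsManifold I 1 M] (Y : Π x : M, TangentSpace I x) : Prop :=
  ContMDiff I I.tangent ∞ (fun x => (⟨x, Y x⟩ : TangentBundle I M))

variable [RiemannianBundle (fun x : M => TangentSpace I x)]

/-- The right-hand side of the Koszul formula:
`½ (X⟨Y,Z⟩ + Y⟨X,Z⟩ - Z⟨X,Y⟩ + ⟨[X,Y],Z⟩ - ⟨[X,Z],Y⟩ - ⟨[Y,Z],X⟩)`. -/
def koszul (X Y Z : Π x : M, TangentSpace I x) (x : M) : ℝ :=
  (1 / 2 : ℝ) *
    (mvfderiv I (fun y => ⟪Y y, Z y⟫_ℝ) x (X x)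
      + mvfderiv I (fun y => ⟪X y, Z y⟫_ℝ) x (Y x)
      - mvfderiv I (fun y => ⟪X y, Y y⟫_ℝ) x (Z x)
      + ⟪mlieBracket I X Y x, Z x⟫_ℝ
      - ⟪mlieBracket I X Z x, Y x⟫_ℝ
      - ⟪mlieBracket I Y Z x, X x⟫_ℝ)

variable [FiniteDimensional ℝ E] [IsManifold I 1 M]

/-- The Levi-Civita covariant derivative `∇_v Y` at `x` of a vector field `Y` in the direction of a
tangent vector `v` at `x`: the tangent vector whose inner products with an orthonormal basis
`(eᵢ)` of the tangent space are given by the Koszul formula. The vectors `v` and `eᵢ` are extended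
to vector fields that are smooth near `x` (the Koszul expression is tensorial in these slots). -/
def leviCivita (Y : Π x : M, TangentSpace I x) (x : M) (v : TangentSpace I x) :
    TangentSpace I x :=
  ∑ i, koszul I (extend E v) Y (extend E (stdOrthonormalBasis ℝ (TangentSpace I x) i)) x •
    stdOrthonormalBasis ℝ (TangentSpace I x) i

/-- The gradient of a real function: `⟨grad f, v⟩ = df(v)`. -/
def riemannianGradient (f : M → ℝ) (x : M) : TangentSpace I x :=
  haveI : CompleteSpace (TangentSpace I x) := FiniteDimensional.complete ℝ _
  (InnerProductSpace.toDual ℝ (TangentSpace I x)).symm (mvfderiv I f x)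

end Riemannian

/-! ### Almost contact metric structures and Sasakian manifolds -/

section Contact

variable {E : Type*} [NormedAddCommGroup E] [NormedSpace ℝ E] [FiniteDimensional ℝ E]
  {H : Type*} [TopologicalSpace H] (I : ModelWithCorners ℝ E H)
  (M : Type*) [TopologicalSpace M] [ChartedSpace H M] [IsManifold I ∞ M]
  [RiemannianBundle (fun x : M => TangentSpace I x)]

/-- An almost contact metric structure `(φ, ξ, η)` on a Riemannian manifold `(M, g)`. -/
structure AlmostContactMetricStructure where
  /-- the `(1,1)`-tensor field `φ` -/
  φ : Π x : M, TangentSpace I x →L[ℝ] TangentSpace I x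
  /-- the characteristic vector field `ξ` -/
  ξ : Π x : M, TangentSpace I x
  /-- the `1`-form `η` -/
  η : Π x : M, TangentSpace I x →L[ℝ] ℝ
  smooth_φ : ContMDiff I (I.prod 𝓘(ℝ, E →L[ℝ] E)) ∞
    (fun x => TotalSpace.mk' (E →L[ℝ] E)
      (E := fun x : M => TangentSpace I x →L[ℝ] TangentSpace I x) x (φ x))
  smooth_ξ : IsSmoothVectorField I ξ
  smooth_η : ContMDiff I (I.prod 𝓘(ℝ, E →L[ℝ] ℝ)) ∞
    (fun x => TotalSpace.mk' (E →L[ℝ] ℝ) (E := fun x : M => TangentSpace I x →L[ℝ] ℝ) x (η x))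
  φ_ξ : ∀ x, φ x (ξ x) = 0
  η_φ : ∀ x v, η x (φ x v) = 0
  η_ξ : ∀ x, η x (ξ x) = 1
  φ_φ : ∀ x v, φ x (φ x v) = -v + η x v • ξ x
  inner_φ_φ : ∀ x v w, ⟪φ x v, φ x w⟫_ℝ = ⟪v, w⟫_ℝ - η x v * η x w

variable {I M}

/-- The almost contact metric structure is Sasakian:
`(∇_X φ)Y = -g(X,Y)ξ + η(Y)X` and `∇_X ξ = φX`, where `(∇_X φ)Y = ∇_X(φY) - φ(∇_X Y)`. -/
structure AlmostContactMetricStructure.IsSasakian (S : AlmostContactMetricStructure I M) :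
    Prop where
  nabla_φ : ∀ Y : Π x : M, TangentSpace I x, IsSmoothVectorField I Y →
    ∀ (x : M) (v : TangentSpace I x),
      leviCivita I (fun y => S.φ y (Y y)) x v - S.φ x (leviCivita I Y x v)
        = -(⟪v, Y x⟫_ℝ • S.ξ x) + S.η x (Y x) • v
  nabla_ξ : ∀ (x : M) (v : TangentSpace I x), leviCivita I S.ξ x v = S.φ x v

end Contact

/-! ### Maps between Riemannian manifolds -/

section Maps

variable {E : Type*} [NormedAddCommGroup E] [NormedSpace ℝ E] [FiniteDimensional ℝ E]
  {H : Type*} [TopologicalSpace H] (I : ModelWithCorners ℝ E H)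
  {M : Type*} [TopologicalSpace M] [ChartedSpace H M] [IsManifold I ∞ M]
  {E' : Type*} [NormedAddCommGroup E'] [NormedSpace ℝ E'] [FiniteDimensional ℝ E']
  {H' : Type*} [TopologicalSpace H'] (J : ModelWithCorners ℝ E' H')
  {N : Type*} [TopologicalSpace N] [ChartedSpace H' N] [IsManifold J ∞ N]
  (f : M → N)

/-- The vertical space `ker f_*` at `p`. -/
def verticalSpace (p : M) : Submodule ℝ (TangentSpace I p) :=
  LinearMap.ker (mfderiv I J f p).toLinearMap

/-- The pullback connection: the covariant derivative `∇^f_v σ` at `p` of a section `σ` of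
`f⁻¹TN`, in the direction `v ∈ T_pM`. Writing `σ = ∑ σⁱ (eᵢ ∘ f)` near `p`, with `(eᵢ)` the local
frame of `TN` around `f p` given by the preferred trivialization, it is
`∑ (v(σⁱ) eᵢ + σⁱ ∇^N_{f_* v} eᵢ)`. -/
def pullbackCovDeriv [RiemannianBundle (fun y : N => TangentSpace J y)]
    (σ : Π q : M, TangentSpace J (f q)) (p : M) (v : TangentSpace I p) :
    TangentSpace J (f p) :=
  letI e := trivializationAt E' (TangentSpace J : N → Type _) (f p)
  letI b := Module.finBasis ℝ E'
  ∑ i, (mvfderiv I (fun q => e.localFrameCoeff J b i (f q) (σ q)) p v • e.localFrame b i (f p)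
    + e.localFrameCoeff J b i (f p) (σ p) •
        leviCivita J (e.localFrame b i) (f p) (mfderiv I J f p v))

variable [RiemannianBundle (fun x : M => TangentSpace I x)]

/-- The horizontal space `(ker f_*)^⊥` at `p`. -/
def horizontalSpace (p : M) : Submodule ℝ (TangentSpace I p) :=
  (verticalSpace I J f p)ᗮ

variable [RiemannianBundle (fun y : N => TangentSpace J y)]

/-- The second fundamental form of a map,
`(∇f_*)(v, Y) = ∇^f_v (f_* Y) - f_*(∇^M_v Y)` at `p`, for `v ∈ T_pM` and a vector field `Y`. -/
def secondFundamentalForm (p : M) (v : TangentSpace I p) (Y : Π x : M, TangentSpace I x) :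
    TangentSpace J (f p) :=
  pullbackCovDeriv I J f (fun q => mfderiv I J f q (Y q)) p v
    - mfderiv I J f p (leviCivita I Y p v)

/-- `f` is a horizontally conformal submersion with dilation `dil`. -/
structure IsHorizontallyConformalSubmersion (dil : M → ℝ) : Prop where
  contMDiff : ContMDiff I J ∞ f
  surjective_mfderiv : ∀ p, Function.Surjective (mfderiv I J f p)
  dil_pos : ∀ p, 0 < dil p
  conformal : ∀ p, ∀ v ∈ horizontalSpace I J f p, ∀ w ∈ horizontalSpace I J f p,
    dil p ^ 2 * ⟪v, w⟫_ℝ = ⟪mfderiv I J f p v, mfderiv I J f p w⟫_ℝ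

/-- `f` with dilation `dil` is horizontally homothetic: the gradient of the dilation exists and
is vertical. -/
def IsHorizontallyHomothetic (dil : M → ℝ) : Prop :=
  ∀ p, MDifferentiableAt I 𝓘(ℝ, ℝ) dil p ∧ riemannianGradient I dil p ∈ verticalSpace I J f p

/-- A conformal anti-invariant `ξ^⊥`-submersion with dilation `dil`: a horizontally conformal
submersion such that `ξ` is horizontal and `φ(ker f_*) ⊆ (ker f_*)^⊥`. -/
structure IsConformalAntiInvariantXiPerpSubmersion (S : AlmostContactMetricStructure I M)
    (dil : M → ℝ) : Prop extends IsHorizontallyConformalSubmersion I J f dil where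
  ξ_horizontal : ∀ p, S.ξ p ∈ horizontalSpace I J f p
  anti_invariant : ∀ p, ∀ u ∈ verticalSpace I J f p, S.φ p u ∈ horizontalSpace I J f p

/-- `(ker f_*)^⊥ = φ(ker f_*) ⊕ ⟨ξ⟩` at every point. -/
def HorizontalEqPhiVerticalOplusXi (S : AlmostContactMetricStructure I M) : Prop :=
  ∀ p, horizontalSpace I J f p
      = (verticalSpace I J f p).map (S.φ p).toLinearMap ⊔ Submodule.span ℝ {S.ξ p}
    ∧ Disjoint ((verticalSpace I J f p).map (S.φ p).toLinearMap) (Submodule.span ℝ {S.ξ p})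

/-- `f` is `(φ ker f_*, μ)`-totally geodesic, for `μ = ⟨ξ⟩`: `(∇f_*)(φU, ξ) = 0` for all vertical
`U`. -/
def IsPhiKerMuTotallyGeodesic (S : AlmostContactMetricStructure I M) : Prop :=
  ∀ p, ∀ u ∈ verticalSpace I J f p, secondFundamentalForm I J f p (S.φ p u) S.ξ = 0

end Maps

end XiPerp

end

open XiPerp

namespace XiPerp

open Filter Topology

set_option maxSynthPendingDepth 3

section Analysis

variable {V W : Type*} [NormedAddCommGroup V] [NormedSpace ℝ V]
  [NormedAddCommGroup W] [NormedSpace ℝ W]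

theorem fderiv_eq_zero_of_nonneg_of_forall_mem {T : V → V → V → ℝ} {x : V}
    (hT : ∀ a b, DifferentiableAt ℝ (fun z => T z a b) x)
    (hadd : ∀ᶠ z in 𝓝 x, ∀ a b, T z (a + b) (a + b) = T z a a + 2 * T z a b + T z b b)
    (hnonneg : ∀ᶠ z in 𝓝 x, ∀ a, 0 ≤ T z a a) {S : Submodule ℝ V}
    (hS : ∀ a ∈ S, T x a a = 0) {a b : V} (ha : a ∈ S) (hb : b ∈ S) :
    fderiv ℝ (fun z => T z a b) x = 0 := by
  have hdiag : ∀ a ∈ S, HasFDerivAt (fun z => T z a a) (0 : V →L[ℝ] ℝ) x := by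
    intro a ha
    have hmin : IsLocalMin (fun z => T z a a) x := by
      filter_upwards [hnonneg] with z hz
      simpa [hS a ha] using hz a
    rw [← hmin.fderiv_eq_zero]
    exact (hT a a).hasFDerivAt
  have hsum := (((hdiag (a + b) (S.add_mem ha hb)).sub (hdiag a ha)).sub (hdiag b hb)).const_mul
    (1 / 2 : ℝ)
  have hab : HasFDerivAt (fun z => T z a b) ((1 / 2 : ℝ) • (0 - 0 - 0 : V →L[ℝ] ℝ)) x := by
    refine hsum.congr_of_eventuallyEq ?_
    filter_upwards [hadd] with z hz
    simp only [Pi.sub_apply, hz a b]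
    ring
  rw [hab.fderiv]
  simp

/-- The Koszul combination of the derivative `A` of a metric in coordinates, i.e. the Christoffel
symbol of the first kind. -/
noncomputable def christoffel (A : V →L[ℝ] V →L[ℝ] V →L[ℝ] ℝ) (a b c : V) : ℝ :=
  (1 / 2 : ℝ) * (A a b c + A b a c - A c a b)

theorem christoffel_pullback {F : V → W} {G : V → V →L[ℝ] V →L[ℝ] ℝ}
    {K : W → W →L[ℝ] W →L[ℝ] ℝ} {l : V → ℝ} {x : V}
    (hF : ContDiffAt ℝ 2 F x) (hG : DifferentiableAt ℝ G x) (hK : DifferentiableAt ℝ K (F x))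
    (hl : DifferentiableAt ℝ l x)
    (hGsymm : ∀ᶠ z in 𝓝 x, ∀ a b, G z a b = G z b a)
    (hKsymm : ∀ y a b, K y a b = K y b a)
    (hle : ∀ᶠ z in 𝓝 x, ∀ a, K (F z) (fderiv ℝ F z a) (fderiv ℝ F z a) ≤ l z * G z a a)
    {S : Submodule ℝ V}
    (hS : ∀ a ∈ S, K (F x) (fderiv ℝ F x a) (fderiv ℝ F x a) = l x * G x a a)
    {a b c : V} (ha : a ∈ S) (hb : b ∈ S) (hc : c ∈ S) :
    K (F x) (fderiv ℝ (fderiv ℝ F) x a b) (fderiv ℝ F x c)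
      + christoffel (fderiv ℝ K (F x)) (fderiv ℝ F x a) (fderiv ℝ F x b) (fderiv ℝ F x c)
      = l x * christoffel (fderiv ℝ G x) a b c
        + (1 / 2 : ℝ) * (fderiv ℝ l x a * G x b c + fderiv ℝ l x b * G x a c
          - fderiv ℝ l x c * G x a b) := by
  have hF1 : HasFDerivAt F (fderiv ℝ F x) x :=
    (hF.differentiableAt (by norm_num)).hasFDerivAt
  have hF2 : HasFDerivAt (fderiv ℝ F) (fderiv ℝ (fderiv ℝ F) x) x :=
    ((hF.fderiv_right (m := 1) (by norm_num)).differentiableAt (by norm_num)).hasFDerivAt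
  have hsnd : ∀ u v, fderiv ℝ (fderiv ℝ F) x u v = fderiv ℝ (fderiv ℝ F) x v u :=
    hF.isSymmSndFDerivAt (by simp)
  have hKF : HasFDerivAt (fun z => K (F z)) ((fderiv ℝ K (F x)).comp (fderiv ℝ F x)) x :=
    HasFDerivAt.comp (g := K) x hK.hasFDerivAt hF1
  let T : V → V → V → ℝ := fun z a b =>
    l z * G z a b - K (F z) (fderiv ℝ F z a) (fderiv ℝ F z b)
  have hTd : ∀ a b, HasFDerivAt (fun z => T z a b) _ x := fun a b =>
    (hl.hasFDerivAt.mul ((hG.hasFDerivAt.clm_apply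
      (hasFDerivAt_const a x)).clm_apply (hasFDerivAt_const b x))).sub
    ((hKF.clm_apply (hF2.clm_apply (hasFDerivAt_const a x))).clm_apply
      (hF2.clm_apply (hasFDerivAt_const b x)))
  have key : ∀ {a b : V}, a ∈ S → b ∈ S → ∀ u,
      fderiv ℝ l x u * G x a b + l x * fderiv ℝ G x u a b
      = fderiv ℝ K (F x) (fderiv ℝ F x u) (fderiv ℝ F x a) (fderiv ℝ F x b)
        + K (F x) (fderiv ℝ (fderiv ℝ F) x u a) (fderiv ℝ F x b)
        + K (F x) (fderiv ℝ F x a) (fderiv ℝ (fderiv ℝ F) x u b) := by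
    intro a b ha hb u
    have hzero : fderiv ℝ (fun z => T z a b) x = 0 := by
      refine fderiv_eq_zero_of_nonneg_of_forall_mem (S := S)
        (fun a b => (hTd a b).differentiableAt) ?_ ?_ ?_ ha hb
      · filter_upwards [hGsymm] with z hz a b
        simp only [T, map_add, add_apply, hz b a,
          hKsymm _ (fderiv ℝ F z b) (fderiv ℝ F z a)]
        ring
      · filter_upwards [hle] with z hz a
        exact sub_nonneg.2 (hz a)
      · intro a ha
        simp only [T, hS a ha, sub_self]
    have := congrArg (fun A => A u) ((hTd a b).fderiv.symm.trans hzero)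
    simp at this
    linarith
  have k1 := key hb hc a
  have k2 := key ha hc b
  have k3 := key ha hb c
  rw [hKsymm _ (fderiv ℝ F x b)] at k1
  rw [hsnd b a] at k2
  rw [hsnd c a, hsnd c b, hKsymm _ (fderiv ℝ (fderiv ℝ F) x a c)] at k3
  unfold christoffel
  rw [hKsymm _ (fderiv ℝ F x b)] at k3
  linarith

end Analysis

section Chart

variable {E : Type*} [NormedAddCommGroup E] [NormedSpace ℝ E]
  {H : Type*} [TopologicalSpace H] (I : ModelWithCorners ℝ E H)
  {M : Type*} [TopologicalSpace M] [ChartedSpace H M] [IsManifold I 1 M]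

/-- The coordinates of tangent vectors at `q` in the chart at `p`. -/
noncomputable def tangentCoord (p q : M) : TangentSpace I q →L[ℝ] E :=
  (trivializationAt E (TangentSpace I : M → Type _) p).continuousLinearMapAt ℝ q

/-- The tangent vector at `q` with given coordinates in the chart at `p`. -/
noncomputable def tangentCoordSymm (p q : M) : E →L[ℝ] TangentSpace I q :=
  (trivializationAt E (TangentSpace I : M → Type _) p).symmL ℝ q

variable {I}

theorem mem_baseSet_of_mem_chart {p q : M} (hq : q ∈ (chartAt H p).source) :
    q ∈ (trivializationAt E (TangentSpace I : M → Type _) p).baseSet := by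
  simpa using hq

theorem tangentCoord_tangentCoordSymm {p q : M} (hq : q ∈ (chartAt H p).source) (a : E) :
    tangentCoord I p q (tangentCoordSymm I p q a) = a :=
  (trivializationAt E (TangentSpace I : M → Type _) p).continuousLinearMapAt_symmL
    (mem_baseSet_of_mem_chart hq) a

theorem tangentCoordSymm_tangentCoord {p q : M} (hq : q ∈ (chartAt H p).source)
    (v : TangentSpace I q) :
    tangentCoordSymm I p q (tangentCoord I p q v) = v :=
  (trivializationAt E (TangentSpace I : M → Type _) p).symmL_continuousLinearMapAt
    (mem_baseSet_of_mem_chart hq) v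

theorem inverse_tangentCoordSymm {p q : M} (hq : q ∈ (chartAt H p).source) :
    (tangentCoordSymm I p q).inverse = tangentCoord I p q := by
  refine ContinuousLinearMap.inverse_eq ?_ ?_
  · ext v; exact tangentCoordSymm_tangentCoord hq v
  · ext v; exact tangentCoord_tangentCoordSymm hq v

theorem inverse_tangentCoord {p q : M} (hq : q ∈ (chartAt H p).source) :
    (tangentCoord I p q).inverse = tangentCoordSymm I p q := by
  refine ContinuousLinearMap.inverse_eq ?_ ?_
  · ext v; exact tangentCoord_tangentCoordSymm hq v
  · ext v; exact tangentCoordSymm_tangentCoord hq v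

theorem extend_eq_tangentCoordSymm {p q : M} (hq : q ∈ (chartAt H p).source)
    (v : TangentSpace I p) :
    extend E v q = tangentCoordSymm I p q (tangentCoord I p p v) := by
  simp only [extend, tangentCoord, tangentCoordSymm]
  rw [Trivialization.continuousLinearMapAt_apply, Trivialization.linearMapAt_apply,
    if_pos (mem_baseSet_of_mem_chart (mem_chart_source H p))]
  exact (Trivialization.symmL_apply _ (mem_baseSet_of_mem_chart hq) _).symm

variable (I) in
/-- A vector field read in the chart at `p`. -/
noncomputable def fieldInChart (p : M) (V : Π x : M, TangentSpace I x) (x : E) : E :=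
  tangentCoord I p ((extChartAt I p).symm x) (V ((extChartAt I p).symm x))

variable [I.Boundaryless]

omit [IsManifold I 1 M] in
theorem eventually_chart (p : M) : ∀ᶠ x in 𝓝 (extChartAt I p p),
    (extChartAt I p).symm x ∈ (chartAt H p).source ∧
      extChartAt I p ((extChartAt I p).symm x) = x := by
  filter_upwards [extChartAt_target_mem_nhds (I := I) p] with x hx
  exact ⟨by simpa using (extChartAt I p).map_target hx, (extChartAt I p).right_inv hx⟩

omit [I.Boundaryless] in
theorem fieldInChart_self (p : M) (V : Π x : M, TangentSpace I x) :
    fieldInChart I p V (extChartAt I p p) = tangentCoord I p p (V p) := by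
  unfold fieldInChart
  rw [extChartAt_to_inv]

theorem fieldInChart_extend {p : M} (v : TangentSpace I p) :
    fieldInChart I p (extend E v) =ᶠ[𝓝 (extChartAt I p p)] fun _ => tangentCoord I p p v := by
  filter_upwards [eventually_chart (I := I) p] with x hx
  rw [fieldInChart, extend_eq_tangentCoordSymm hx.1, tangentCoord_tangentCoordSymm hx.1]

variable {F : Type*} [NormedAddCommGroup F] [NormedSpace ℝ F]

omit [IsManifold I 1 M] in
theorem differentiableAt_comp_chart {φ : M → F} {p : M} (hφ : MDifferentiableAt I 𝓘(ℝ, F) φ p) :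
    DifferentiableAt ℝ (fun x => φ ((extChartAt I p).symm x)) (extChartAt I p p) := by
  have := (mdifferentiableAt_iff _ _).1 hφ |>.2
  rw [I.range_eq_univ] at this
  exact differentiableWithinAt_univ.1 this

omit [IsManifold I 1 M] [I.Boundaryless] [NormedAddCommGroup F] [NormedSpace ℝ F] in
theorem eventuallyEq_comp_chart (φ : M → F) (p : M) :
    φ =ᶠ[𝓝 p] (fun x => φ ((extChartAt I p).symm x)) ∘ extChartAt I p := by
  filter_upwards [extChartAt_source_mem_nhds (I := I) p] with q hq
  simp only [Function.comp_def, (extChartAt I p).left_inv hq]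

omit [I.Boundaryless] in
theorem mdifferentiableAt_of_comp_chart {φ : M → F} {p : M}
    (hφ : DifferentiableAt ℝ (fun x => φ ((extChartAt I p).symm x)) (extChartAt I p p)) :
    MDifferentiableAt I 𝓘(ℝ, F) φ p :=
  (MDifferentiableAt.comp p hφ.mdifferentiableAt
    (mdifferentiableAt_extChartAt (mem_chart_source H p))).congr_of_eventuallyEq
    (eventuallyEq_comp_chart φ p)

omit [I.Boundaryless] in
theorem mvfderiv_eq_fderiv {φ : M → F} {p : M}
    (hφ : DifferentiableAt ℝ (fun x => φ ((extChartAt I p).symm x)) (extChartAt I p p))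
    (v : TangentSpace I p) :
    mvfderiv I φ p v
      = fderiv ℝ (fun x => φ ((extChartAt I p).symm x)) (extChartAt I p p) (tangentCoord I p p v) := by
  have h2 : MDifferentiableAt I 𝓘(ℝ, E) (extChartAt I p) p :=
    mdifferentiableAt_extChartAt (mem_chart_source H p)
  unfold mvfderiv
  rw [(eventuallyEq_comp_chart (I := I) φ p).mfderiv_eq, mfderiv_comp p hφ.mdifferentiableAt h2,
    mfderiv_eq_fderiv, tangentCoord,
    TangentBundle.continuousLinearMapAt_trivializationAt (mem_chart_source H p)]
  rfl

theorem fieldInChart_eq_mpullbackWithin (p : M) (V : Π x : M, TangentSpace I x) :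
    mpullbackWithin 𝓘(ℝ, E) I (extChartAt I p).symm V (Set.range I)
      =ᶠ[𝓝 (extChartAt I p p)] fieldInChart I p V := by
  filter_upwards [eventually_chart (I := I) p] with x hx
  rw [mpullbackWithin_apply]
  have h1 := TangentBundle.symmL_trivializationAt (I := I) (x₀ := p) hx.1
  rw [hx.2] at h1
  rw [← h1]
  exact congrArg (fun A : TangentSpace I ((extChartAt I p).symm x) →L[ℝ] E =>
    A (V ((extChartAt I p).symm x))) (inverse_tangentCoordSymm (E := E) (I := I) hx.1)

theorem differentiableAt_fieldInChart [IsManifold I 2 M] [CompleteSpace E] {p : M}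
    {V : Π x : M, TangentSpace I x}
    (hV : MDifferentiableAt I I.tangent (fun x => (⟨x, V x⟩ : TangentBundle I M)) p) :
    DifferentiableAt ℝ (fieldInChart I p V) (extChartAt I p p) := by
  let W : E → E := mpullbackWithin 𝓘(ℝ, E) I (extChartAt I p).symm V (Set.range I)
  have hW : W =ᶠ[𝓝 (extChartAt I p p)] fieldInChart I p V := fieldInChart_eq_mpullbackWithin p V
  have hd : DifferentiableWithinAt ℝ W
      ((extChartAt I p).symm ⁻¹' Set.univ ∩ Set.range I) (extChartAt I p p) :=
    MDifferentiableWithinAt.differentiableWithinAt_mpullbackWithin_vectorField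
      (mdifferentiableWithinAt_univ.2 hV)
  have hs : (extChartAt I p).symm ⁻¹' Set.univ ∩ Set.range I ∈ 𝓝 (extChartAt I p p) := by
    simp [I.range_eq_univ]
  exact (hd.differentiableAt hs).congr_of_eventuallyEq hW.symm

theorem tangentCoord_mlieBracket (p : M) (V W : Π x : M, TangentSpace I x) :
    tangentCoord I p p (mlieBracket I V W p)
      = lieBracket ℝ (fieldInChart I p V) (fieldInChart I p W) (extChartAt I p p) := by
  have hb : lieBracketWithin ℝ (mpullbackWithin 𝓘(ℝ, E) I (extChartAt I p).symm V (Set.range I))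
        (mpullbackWithin 𝓘(ℝ, E) I (extChartAt I p).symm W (Set.range I))
        ((extChartAt I p).symm ⁻¹' Set.univ ∩ Set.range I) (extChartAt I p p)
      = lieBracket ℝ (fieldInChart I p V) (fieldInChart I p W) (extChartAt I p p) := by
    have hs : (extChartAt I p).symm ⁻¹' Set.univ ∩ Set.range I = Set.univ := by
      simp [I.range_eq_univ]
    exact (congrArg (fun s => lieBracketWithin ℝ _ _ s _) hs).trans
      ((congrFun lieBracketWithin_univ _).trans
        ((fieldInChart_eq_mpullbackWithin p V).lieBracket_vectorField_eq
          (fieldInChart_eq_mpullbackWithin p W)))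
  rw [← mlieBracketWithin_univ, mlieBracketWithin_apply, hb]
  rw [← TangentBundle.continuousLinearMapAt_trivializationAt (mem_chart_source H p)]
  exact (congrArg (fun A : E →L[ℝ] TangentSpace I p => tangentCoord I p p (A _))
    (inverse_tangentCoord (mem_chart_source H p))).trans
    (tangentCoord_tangentCoordSymm (mem_chart_source H p) _)

end Chart

section Metric

variable {E : Type*} [NormedAddCommGroup E] [NormedSpace ℝ E] [FiniteDimensional ℝ E]
  {H : Type*} [TopologicalSpace H] (I : ModelWithCorners ℝ E H)
  {M : Type*} [TopologicalSpace M] [ChartedSpace H M] [IsManifold I 1 M]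
  [RiemannianBundle (fun x : M => TangentSpace I x)]

/-- The Riemannian metric read in the chart at `p`. -/
noncomputable def metricInChart (p : M) (x : E) : E →L[ℝ] E →L[ℝ] ℝ :=
  letI b := Module.finBasis ℝ E
  letI s := tangentCoordSymm I p ((extChartAt I p).symm x)
  ∑ i, ∑ j, ⟪s (b i), s (b j)⟫_ℝ •
    (b.coord i).toContinuousLinearMap.smulRight (b.coord j).toContinuousLinearMap

variable {I}

theorem metricInChart_apply (p : M) (x : E) (a b : E) :
    metricInChart I p x a b
      = ⟪tangentCoordSymm I p ((extChartAt I p).symm x) a,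
          tangentCoordSymm I p ((extChartAt I p).symm x) b⟫_ℝ := by
  conv_rhs => rw [← (Module.finBasis ℝ E).sum_repr a, ← (Module.finBasis ℝ E).sum_repr b]
  simp only [metricInChart, map_sum, map_smul, sum_inner, inner_sum, real_inner_smul_left,
    real_inner_smul_right, sum_apply, smul_apply,
    ContinuousLinearMap.smulRight_apply, LinearMap.coe_toContinuousLinearMap',
    Module.Basis.coord_apply, smul_eq_mul]
  rw [Finset.sum_comm]
  exact Finset.sum_congr rfl fun i _ => Finset.sum_congr rfl fun j _ => by ring

theorem metricInChart_comm (p : M) (x : E) (a b : E) :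
    metricInChart I p x a b = metricInChart I p x b a := by
  rw [metricInChart_apply, metricInChart_apply, real_inner_comm]

theorem metricInChart_self (p : M) (v w : TangentSpace I p) :
    metricInChart I p (extChartAt I p p) (tangentCoord I p p v) (tangentCoord I p p w)
      = ⟪v, w⟫_ℝ := by
  rw [metricInChart_apply, extChartAt_to_inv,
    tangentCoordSymm_tangentCoord (mem_chart_source H p),
    tangentCoordSymm_tangentCoord (mem_chart_source H p)]

variable [I.Boundaryless]

theorem inner_eventually_eq_metricInChart (p : M) (V W : Π x : M, TangentSpace I x) :
    (fun x => ⟪V ((extChartAt I p).symm x), W ((extChartAt I p).symm x)⟫_ℝ)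
      =ᶠ[𝓝 (extChartAt I p p)]
      fun x => metricInChart I p x (fieldInChart I p V x) (fieldInChart I p W x) := by
  filter_upwards [eventually_chart (I := I) p] with x hx
  rw [metricInChart_apply, fieldInChart, fieldInChart, tangentCoordSymm_tangentCoord hx.1,
    tangentCoordSymm_tangentCoord hx.1]

end Metric

section LeviCivita

variable {E : Type*} [NormedAddCommGroup E] [NormedSpace ℝ E] [FiniteDimensional ℝ E]
  {H : Type*} [TopologicalSpace H] {I : ModelWithCorners ℝ E H} [I.Boundaryless]
  {M : Type*} [TopologicalSpace M] [ChartedSpace H M] [IsManifold I ∞ M]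
  [RiemannianBundle (fun x : M => TangentSpace I x)]
  [IsContMDiffRiemannianBundle I ∞ E (fun x : M => TangentSpace I x)]

omit [FiniteDimensional ℝ E] [I.Boundaryless] in
theorem mdifferentiableAt_inner {p : M} {V W : Π x : M, TangentSpace I x}
    (hV : MDifferentiableAt I I.tangent (fun x => (⟨x, V x⟩ : TangentBundle I M)) p)
    (hW : MDifferentiableAt I I.tangent (fun x => (⟨x, W x⟩ : TangentBundle I M)) p) :
    MDifferentiableAt I 𝓘(ℝ, ℝ) (fun x => ⟪V x, W x⟫_ℝ) p := by
  have : IsContMDiffRiemannianBundle I 1 E (fun x : M => TangentSpace I x) :=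
    IsContMDiffRiemannianBundle.of_le (n := ∞) (by simp)
  exact MDifferentiableAt.inner_bundle hV hW

omit [FiniteDimensional ℝ E] [I.Boundaryless] [RiemannianBundle (fun x : M => TangentSpace I x)]
  [IsContMDiffRiemannianBundle I ∞ E (fun x : M => TangentSpace I x)] in
theorem mdifferentiableAt_extend' {p : M} (v : TangentSpace I p) :
    MDifferentiableAt I I.tangent (fun x => (⟨x, extend E v x⟩ : TangentBundle I M)) p :=
  mdifferentiableAt_extend I E v

theorem differentiableAt_metricInChart (p : M) :
    DifferentiableAt ℝ (metricInChart I p) (extChartAt I p p) := by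
  have hab : ∀ a b : E, DifferentiableAt ℝ (fun x =>
      ⟪tangentCoordSymm I p ((extChartAt I p).symm x) a,
        tangentCoordSymm I p ((extChartAt I p).symm x) b⟫_ℝ) (extChartAt I p p) := by
    intro a b
    have h := differentiableAt_comp_chart
      (mdifferentiableAt_inner (mdifferentiableAt_extend' (tangentCoordSymm I p p a))
        (mdifferentiableAt_extend' (tangentCoordSymm I p p b)))
    refine h.congr_of_eventuallyEq ?_
    filter_upwards [eventually_chart (I := I) p] with x hx
    rw [extend_eq_tangentCoordSymm hx.1, extend_eq_tangentCoordSymm hx.1,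
      tangentCoord_tangentCoordSymm (mem_chart_source H p),
      tangentCoord_tangentCoordSymm (mem_chart_source H p)]
  exact DifferentiableAt.fun_sum (𝕜 := ℝ) (E := E) (F := E →L[ℝ] E →L[ℝ] ℝ) fun i _ =>
    DifferentiableAt.fun_sum (𝕜 := ℝ) (E := E) (F := E →L[ℝ] E →L[ℝ] ℝ) fun j _ =>
      (hab _ _).smul_const (F := E →L[ℝ] E →L[ℝ] ℝ) _

theorem mvfderiv_inner {p : M} {V W : Π x : M, TangentSpace I x}
    (hV : MDifferentiableAt I I.tangent (fun x => (⟨x, V x⟩ : TangentBundle I M)) p)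
    (hW : MDifferentiableAt I I.tangent (fun x => (⟨x, W x⟩ : TangentBundle I M)) p)
    (u : TangentSpace I p) :
    letI x := extChartAt I p p
    letI c := tangentCoord I p p
    mvfderiv I (fun q => ⟪V q, W q⟫_ℝ) p u
      = fderiv ℝ (metricInChart I p) x (c u) (c (V p)) (c (W p))
        + metricInChart I p x (fderiv ℝ (fieldInChart I p V) x (c u)) (c (W p))
        + metricInChart I p x (c (V p)) (fderiv ℝ (fieldInChart I p W) x (c u)) := by
  rw [mvfderiv_eq_fderiv (differentiableAt_comp_chart (mdifferentiableAt_inner hV hW)),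
    (inner_eventually_eq_metricInChart p V W).fderiv_eq]
  have hG := (differentiableAt_metricInChart (I := I) p).hasFDerivAt
  have hV' := (differentiableAt_fieldInChart hV).hasFDerivAt
  have hW' := (differentiableAt_fieldInChart hW).hasFDerivAt
  rw [((hG.clm_apply hV').clm_apply hW').fderiv]
  simp only [fieldInChart_self, add_apply, ContinuousLinearMap.comp_apply,
    ContinuousLinearMap.flip_apply]
  ring

theorem koszul_extend_eq {p : M} {Y : Π x : M, TangentSpace I x}
    (hY : MDifferentiableAt I I.tangent (fun x => (⟨x, Y x⟩ : TangentBundle I M)) p)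
    (v w : TangentSpace I p) :
    letI x := extChartAt I p p
    letI c := tangentCoord I p p
    koszul I (extend E v) Y (extend E w) p
      = metricInChart I p x (fderiv ℝ (fieldInChart I p Y) x (c v)) (c w)
        + christoffel (fderiv ℝ (metricInChart I p) x) (c v) (c (Y p)) (c w) := by
  have hv := mdifferentiableAt_extend' (I := I) v
  have hw := mdifferentiableAt_extend' (I := I) w
  have hcv : fderiv ℝ (fieldInChart I p (extend E v)) (extChartAt I p p) = 0 := by
    rw [(fieldInChart_extend v).fderiv_eq]; simp
  have hcw : fderiv ℝ (fieldInChart I p (extend E w)) (extChartAt I p p) = 0 := by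
    rw [(fieldInChart_extend w).fderiv_eq]; simp
  unfold koszul
  rw [mvfderiv_inner hY hw, mvfderiv_inner hv hw, mvfderiv_inner hv hY,
    ← metricInChart_self p (mlieBracket I (extend E v) Y p),
    ← metricInChart_self p (mlieBracket I (extend E v) (extend E w) p),
    ← metricInChart_self p (mlieBracket I Y (extend E w) p)]
  simp only [tangentCoord_mlieBracket, lieBracket, hcv, hcw, fieldInChart_self, extend_apply_self,
    christoffel, map_zero, zero_apply, sub_zero, zero_sub, map_neg,
    neg_apply]
  rw [metricInChart_comm p _ (tangentCoord I p p v)]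
  ring

theorem inner_leviCivita {p : M} {Y : Π x : M, TangentSpace I x}
    (hY : MDifferentiableAt I I.tangent (fun x => (⟨x, Y x⟩ : TangentBundle I M)) p)
    (v w : TangentSpace I p) :
    letI x := extChartAt I p p
    letI c := tangentCoord I p p
    ⟪leviCivita I Y p v, w⟫_ℝ
      = metricInChart I p x (fderiv ℝ (fieldInChart I p Y) x (c v)) (c w)
        + christoffel (fderiv ℝ (metricInChart I p) x) (c v) (c (Y p)) (c w) := by
  set b := stdOrthonormalBasis ℝ (TangentSpace I p)
  have hw : w = ∑ i, ⟪b i, w⟫_ℝ • b i := (b.sum_repr' w).symm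
  unfold leviCivita
  simp only [koszul_extend_eq hY, sum_inner, real_inner_smul_left]
  conv_rhs => rw [hw]
  simp only [map_sum, map_smul, christoffel, sum_apply,
    smul_apply, smul_eq_mul, ← Finset.sum_add_distrib,
    ← Finset.sum_sub_distrib, Finset.mul_sum]
  exact Finset.sum_congr rfl fun i _ => by ring

end LeviCivita

section MapInChart

variable {E : Type*} [NormedAddCommGroup E] [NormedSpace ℝ E]
  {H : Type*} [TopologicalSpace H] (I : ModelWithCorners ℝ E H)
  {M : Type*} [TopologicalSpace M] [ChartedSpace H M]
  {E' : Type*} [NormedAddCommGroup E'] [NormedSpace ℝ E']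
  {H' : Type*} [TopologicalSpace H'] (J : ModelWithCorners ℝ E' H')
  {N : Type*} [TopologicalSpace N] [ChartedSpace H' N]

/-- A map read in the charts at `p` and `f p`. -/
noncomputable def mapInChart (f : M → N) (p : M) (x : E) : E' :=
  extChartAt J (f p) (f ((extChartAt I p).symm x))

variable {I J} {f : M → N}

theorem mapInChart_self (p : M) :
    mapInChart I J f p (extChartAt I p p) = extChartAt J (f p) (f p) := by
  rw [mapInChart, extChartAt_to_inv]

variable [I.Boundaryless]

theorem contDiffAt_mapInChart {p : M} (hf : ContMDiffAt I J ∞ f p) :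
    ContDiffAt ℝ ∞ (mapInChart I J f p) (extChartAt I p p) := by
  have := (contMDiffAt_iff.1 hf).2
  rw [I.range_eq_univ] at this
  exact contDiffWithinAt_univ.1 this

omit [I.Boundaryless] in
theorem eventually_map_chart {p : M} (hf : ContinuousAt f p) :
    ∀ᶠ x in 𝓝 (extChartAt I p p),
      f ((extChartAt I p).symm x) ∈ (chartAt H' (f p)).source := by
  have h := hf.eventually ((chartAt H' (f p)).open_source.mem_nhds (mem_chart_source H' (f p)))
  have h2 := continuousAt_extChartAt_symm (I := I) p
  rw [ContinuousAt, extChartAt_to_inv] at h2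
  exact h2.eventually h

variable [IsManifold I 1 M] [IsManifold J 1 N]

theorem tangentCoord_mfderiv {p : M} {x : E} (hx : (extChartAt I p).symm x ∈ (chartAt H p).source)
    (hx' : extChartAt I p ((extChartAt I p).symm x) = x)
    (hfx : f ((extChartAt I p).symm x) ∈ (chartAt H' (f p)).source)
    (hf : MDifferentiableAt I J f ((extChartAt I p).symm x)) (a : E) :
    tangentCoord J (f p) (f ((extChartAt I p).symm x))
      (mfderiv I J f ((extChartAt I p).symm x)
        (tangentCoordSymm I p ((extChartAt I p).symm x) a))
      = fderiv ℝ (mapInChart I J f p) x a := by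
  have h1 := TangentBundle.symmL_trivializationAt (I := I) hx
  rw [hx', I.range_eq_univ, mfderivWithin_univ] at h1
  have h2 := TangentBundle.continuousLinearMapAt_trivializationAt (I := J) hfx
  have hc : MDifferentiableAt 𝓘(ℝ, E) I (extChartAt I p).symm x := by
    have := mdifferentiableWithinAt_extChartAt_symm (I := I) (x := p) (z := x)
      (hx' ▸ (extChartAt I p).map_source (by simpa using hx))
    rwa [I.range_eq_univ, mdifferentiableWithinAt_univ] at this
  have hd : MDifferentiableAt J 𝓘(ℝ, E') (extChartAt J (f p)) (f ((extChartAt I p).symm x)) :=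
    mdifferentiableAt_extChartAt hfx
  have h3 := mfderiv_comp x (hd.comp _ hf) hc
  rw [mfderiv_comp _ hd hf] at h3
  rw [tangentCoord, tangentCoordSymm, h1, h2, ← mfderiv_eq_fderiv]
  exact (congrArg (fun A : E →L[ℝ] E' => A a) h3).symm

theorem tangentCoord_mfderiv_self {p : M} (hf : MDifferentiableAt I J f p) (v : TangentSpace I p) :
    tangentCoord J (f p) (f p) (mfderiv I J f p v)
      = fderiv ℝ (mapInChart I J f p) (extChartAt I p p) (tangentCoord I p p v) := by
  have hx := (eventually_chart (I := I) p).self_of_nhds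
  have h := tangentCoord_mfderiv (f := f) (J := J) hx.1 hx.2
  rw [extChartAt_to_inv] at h
  rw [← h (mem_chart_source H' (f p)) hf, tangentCoordSymm_tangentCoord (mem_chart_source H p)]

theorem tangentCoord_mfderiv_field {p : M} (hf : ContMDiff I J ∞ f)
    (Y : Π x : M, TangentSpace I x) :
    (fun x => tangentCoord J (f p) (f ((extChartAt I p).symm x))
      (mfderiv I J f ((extChartAt I p).symm x) (Y ((extChartAt I p).symm x))))
    =ᶠ[𝓝 (extChartAt I p p)] fun x => fderiv ℝ (mapInChart I J f p) x (fieldInChart I p Y x) := by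
  filter_upwards [eventually_chart (I := I) p,
    eventually_map_chart (I := I) (H' := H') (hf.continuous.continuousAt (x := p))] with x hx hfx
  rw [← tangentCoord_mfderiv hx.1 hx.2 hfx (hf.mdifferentiableAt (by simp)), fieldInChart,
    tangentCoordSymm_tangentCoord hx.1]

end MapInChart

section Frame

variable {E' : Type*} [NormedAddCommGroup E'] [NormedSpace ℝ E']
  {H' : Type*} [TopologicalSpace H'] (J : ModelWithCorners ℝ E' H')
  {N : Type*} [TopologicalSpace N] [ChartedSpace H' N] [IsManifold J ∞ N]
  {ι : Type*} (b : Module.Basis ι ℝ E')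

theorem localFrameCoeff_eq_repr {y z : N} (hz : z ∈ (chartAt H' y).source)
    (w : TangentSpace J z) (i : ι) :
    (trivializationAt E' (TangentSpace J : N → Type _) y).localFrameCoeff J b i z w
      = b.repr (tangentCoord J y z w) i := by
  have hz' := mem_baseSet_of_mem_chart (I := J) hz
  have h := Trivialization.localFrameCoeff_apply_of_mem_baseSet (I := J)
    (trivializationAt E' (TangentSpace J : N → Type _) y) b hz' (extend E' w) i
  rw [extend_apply_self] at h
  rw [h, Trivialization.basisAt, Module.Basis.map_repr, tangentCoord,
    Trivialization.continuousLinearMapAt_apply, Trivialization.linearMapAt_apply, if_pos hz']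
  rfl

theorem tangentCoord_localFrame {y z : N} (hz : z ∈ (chartAt H' y).source) (i : ι) :
    tangentCoord J y z
      ((trivializationAt E' (TangentSpace J : N → Type _) y).localFrame b i z) = b i := by
  have hz' := mem_baseSet_of_mem_chart (I := J) hz
  rw [Trivialization.localFrame_apply_of_mem_baseSet _ _ hz', ← tangentCoord_tangentCoordSymm (I := J) hz (b i),
    tangentCoordSymm, Trivialization.symmL_apply _ hz']
  rfl

end Frame

section Pullback

variable {E : Type*} [NormedAddCommGroup E] [NormedSpace ℝ E] [FiniteDimensional ℝ E]
  {H : Type*} [TopologicalSpace H] {I : ModelWithCorners ℝ E H} [I.Boundaryless]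
  {M : Type*} [TopologicalSpace M] [ChartedSpace H M] [IsManifold I ∞ M]
  {E' : Type*} [NormedAddCommGroup E'] [NormedSpace ℝ E'] [FiniteDimensional ℝ E']
  {H' : Type*} [TopologicalSpace H'] {J : ModelWithCorners ℝ E' H'} [J.Boundaryless]
  {N : Type*} [TopologicalSpace N] [ChartedSpace H' N] [IsManifold J ∞ N]
  [RiemannianBundle (fun y : N => TangentSpace J y)]
  [IsContMDiffRiemannianBundle J ∞ E' (fun y : N => TangentSpace J y)]
  {f : M → N}

theorem inner_leviCivita_localFrame {ι : Type*} (b : Module.Basis ι ℝ E') (y : N) (i : ι)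
    (v w : TangentSpace J y) :
    ⟪leviCivita J ((trivializationAt E' (TangentSpace J : N → Type _) y).localFrame b i) y v, w⟫_ℝ
      = christoffel (fderiv ℝ (metricInChart J y) (extChartAt J y y)) (tangentCoord J y y v) (b i)
          (tangentCoord J y y w) := by
  have hY : MDifferentiableAt J J.tangent (fun x => (⟨x, (trivializationAt E'
      (TangentSpace J : N → Type _) y).localFrame b i x⟩ : TangentBundle J N)) y :=
    (contMDiffAt_localFrame_of_mem 1 (trivializationAt E' (TangentSpace J : N → Type _) y) b i
      (mem_baseSet_of_mem_chart (mem_chart_source H' y))).mdifferentiableAt (by simp)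
  have hconst : fieldInChart J y ((trivializationAt E'
      (TangentSpace J : N → Type _) y).localFrame b i) =ᶠ[𝓝 (extChartAt J y y)] fun _ => b i := by
    filter_upwards [eventually_chart (I := J) y] with x hx
    exact tangentCoord_localFrame J b hx.1 i
  rw [inner_leviCivita hY, hconst.fderiv_eq,
    tangentCoord_localFrame J b (mem_chart_source H' y)]
  simp

theorem inner_pullbackCovDeriv {p : M} (hf : ContMDiff I J ∞ f) {Y : Π x : M, TangentSpace I x}
    (hY : MDifferentiableAt I I.tangent (fun x => (⟨x, Y x⟩ : TangentBundle I M)) p)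
    (v : TangentSpace I p) (w : TangentSpace J (f p)) :
    letI x := extChartAt I p p
    letI c := tangentCoord I p p
    letI F := mapInChart I J f p
    letI K := metricInChart J (f p)
    ⟪pullbackCovDeriv I J f (fun q => mfderiv I J f q (Y q)) p v, w⟫_ℝ
      = K (F x) (fderiv ℝ (fderiv ℝ F) x (c v) (c (Y p))
          + fderiv ℝ F x (fderiv ℝ (fieldInChart I p Y) x (c v))) (tangentCoord J (f p) (f p) w)
        + christoffel (fderiv ℝ K (F x)) (fderiv ℝ F x (c v)) (fderiv ℝ F x (c (Y p)))
            (tangentCoord J (f p) (f p) w) := by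
  set b := Module.finBasis ℝ E'
  set x := extChartAt I p p
  set c := tangentCoord I p p
  set F := mapInChart I J f p
  set K := metricInChart J (f p)
  set e := trivializationAt E' (TangentSpace J : N → Type _) (f p)
  set w' := tangentCoord J (f p) (f p) w
  have hFx : F x = extChartAt J (f p) (f p) := mapInChart_self p
  have hmd : MDifferentiableAt I J f p := hf.mdifferentiableAt (by simp)
  have hF2 : HasFDerivAt (fderiv ℝ F) (fderiv ℝ (fderiv ℝ F) x) x :=
    (((contDiffAt_mapInChart (hf p)).fderiv_right (m := 1) (by norm_cast)).differentiableAt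
      (by norm_num)).hasFDerivAt
  have hσ : HasFDerivAt (fun z => fderiv ℝ F z (fieldInChart I p Y z)) _ x :=
    hF2.clm_apply (differentiableAt_fieldInChart hY).hasFDerivAt
  set D := fderiv ℝ (fderiv ℝ F) x (c v) (c (Y p))
    + fderiv ℝ F x (fderiv ℝ (fieldInChart I p Y) x (c v)) with hD
  have hcoeff : ∀ i, mvfderiv I
      (fun q => e.localFrameCoeff J b i (f q) (mfderiv I J f q (Y q))) p v = b.repr D i := by
    intro i
    let L : E' →L[ℝ] ℝ := (b.coord i).toContinuousLinearMap
    have heq : (fun z => e.localFrameCoeff J b i (f ((extChartAt I p).symm z))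
        (mfderiv I J f ((extChartAt I p).symm z) (Y ((extChartAt I p).symm z))))
        =ᶠ[𝓝 x] fun z => L (fderiv ℝ F z (fieldInChart I p Y z)) := by
      filter_upwards [tangentCoord_mfderiv_field hf Y,
        eventually_map_chart (I := I) (H' := H') (hf.continuous.continuousAt (x := p))] with z hz hfz
      rw [localFrameCoeff_eq_repr J b hfz, hz]
      rfl
    have hd := (L.hasFDerivAt.comp x hσ).congr_of_eventuallyEq heq
    rw [mvfderiv_eq_fderiv hd.differentiableAt, hd.fderiv]
    have hYx : fieldInChart I p Y x = c (Y p) := fieldInChart_self p Y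
    simp only [hYx, ContinuousLinearMap.comp_apply, add_apply, ContinuousLinearMap.flip_apply]
    rw [add_comm]
    rfl
  have hY0 : ∀ i, e.localFrameCoeff J b i (f p) (mfderiv I J f p (Y p))
      = b.repr (fderiv ℝ F x (c (Y p))) i := by
    intro i
    rw [localFrameCoeff_eq_repr J b (mem_chart_source H' (f p)), tangentCoord_mfderiv_self hmd]
  have hin : ∀ i, ⟪e.localFrame b i (f p), w⟫_ℝ = K (F x) (b i) w' := by
    intro i
    rw [hFx, ← tangentCoord_localFrame J b (mem_chart_source H' (f p)) i, metricInChart_self]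
  have hlc : ∀ i, ⟪leviCivita J (e.localFrame b i) (f p) (mfderiv I J f p v), w⟫_ℝ
      = christoffel (fderiv ℝ K (F x)) (fderiv ℝ F x (c v)) (b i) w' := by
    intro i
    rw [inner_leviCivita_localFrame, tangentCoord_mfderiv_self hmd, hFx]
  change ⟪∑ i, (mvfderiv I (fun q => e.localFrameCoeff J b i (f q) (mfderiv I J f q (Y q))) p v •
      e.localFrame b i (f p) + e.localFrameCoeff J b i (f p) (mfderiv I J f p (Y p)) •
        leviCivita J (e.localFrame b i) (f p) (mfderiv I J f p v)), w⟫_ℝ = _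
  simp only [hcoeff, hY0, sum_inner, inner_add_left, real_inner_smul_left, hlc, hin]
  conv_rhs => rw [← b.sum_repr D, ← b.sum_repr (fderiv ℝ F x (c (Y p)))]
  simp only [map_sum, map_smul, christoffel, sum_apply, smul_apply, smul_eq_mul,
    ← Finset.sum_add_distrib, ← Finset.sum_sub_distrib, Finset.mul_sum]
  exact Finset.sum_congr rfl fun i _ => by ring

end Pullback

section Conformal

variable {E : Type*} [NormedAddCommGroup E] [NormedSpace ℝ E] [FiniteDimensional ℝ E]
  {H : Type*} [TopologicalSpace H] {I : ModelWithCorners ℝ E H}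
  {M : Type*} [TopologicalSpace M] [ChartedSpace H M] [IsManifold I ∞ M]
  [RiemannianBundle (fun x : M => TangentSpace I x)]
  {E' : Type*} [NormedAddCommGroup E'] [NormedSpace ℝ E'] [FiniteDimensional ℝ E']
  {H' : Type*} [TopologicalSpace H'] {J : ModelWithCorners ℝ E' H'}
  {N : Type*} [TopologicalSpace N] [ChartedSpace H' N] [IsManifold J ∞ N]
  [RiemannianBundle (fun y : N => TangentSpace J y)]
  {f : M → N} {dil : M → ℝ}

omit [IsManifold I ∞ M] [FiniteDimensional ℝ E'] [IsManifold J ∞ N]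
  [RiemannianBundle (fun y : N => TangentSpace J y)] in
theorem exists_horizontal_add_vertical (p : M) (v : TangentSpace I p) :
    ∃ h ∈ horizontalSpace I J f p, ∃ u ∈ verticalSpace I J f p,
      v = u + h ∧ mfderiv I J f p v = mfderiv I J f p h := by
  obtain ⟨u, hu, h, hh, rfl⟩ := (verticalSpace I J f p).exists_add_mem_mem_orthogonal v
  refine ⟨h, hh, u, hu, rfl, ?_⟩
  have : mfderiv I J f p u = 0 := hu
  rw [map_add, this, zero_add]

variable (hf : IsHorizontallyConformalSubmersion I J f dil)
include hf

omit [IsManifold I ∞ M] [FiniteDimensional ℝ E'] [IsManifold J ∞ N] in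
theorem IsHorizontallyConformalSubmersion.inner_mfderiv {p : M} (v : TangentSpace I p)
    {w : TangentSpace I p} (hw : w ∈ horizontalSpace I J f p) :
    ⟪mfderiv I J f p v, mfderiv I J f p w⟫_ℝ = dil p ^ 2 * ⟪v, w⟫_ℝ := by
  obtain ⟨h, hh, u, hu, rfl, hv⟩ := exists_horizontal_add_vertical (J := J) (f := f) p v
  rw [hv, ← hf.conformal p h hh w hw, inner_add_left,
    Submodule.inner_right_of_mem_orthogonal hu hw, zero_add]

omit [IsManifold I ∞ M] [FiniteDimensional ℝ E'] [IsManifold J ∞ N] in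
theorem IsHorizontallyConformalSubmersion.inner_mfderiv_self_le {p : M} (v : TangentSpace I p) :
    ⟪mfderiv I J f p v, mfderiv I J f p v⟫_ℝ ≤ dil p ^ 2 * ⟪v, v⟫_ℝ := by
  obtain ⟨h, hh, u, hu, rfl, hv⟩ := exists_horizontal_add_vertical (J := J) (f := f) p v
  rw [hv, ← hf.conformal p h hh h hh]
  refine mul_le_mul_of_nonneg_left ?_ (sq_nonneg _)
  rw [real_inner_add_add_self, Submodule.inner_right_of_mem_orthogonal hu hh]
  linarith [real_inner_self_nonneg (x := u)]

variable [I.Boundaryless] [J.Boundaryless]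
  [IsContMDiffRiemannianBundle I ∞ E (fun x : M => TangentSpace I x)]
  [IsContMDiffRiemannianBundle J ∞ E' (fun y : N => TangentSpace J y)]

theorem IsHorizontallyConformalSubmersion.inner_secondFundamentalForm {p : M}
    (hdil : MDifferentiableAt I 𝓘(ℝ, ℝ) (fun q => dil q ^ 2) p) {Y : Π x : M, TangentSpace I x}
    (hY : MDifferentiableAt I I.tangent (fun x => (⟨x, Y x⟩ : TangentBundle I M)) p)
    (hYh : Y p ∈ horizontalSpace I J f p) {v w : TangentSpace I p}
    (hv : v ∈ horizontalSpace I J f p) (hw : w ∈ horizontalSpace I J f p) :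
    letI dl := mvfderiv I (fun q => dil q ^ 2) p
    ⟪secondFundamentalForm I J f p v Y, mfderiv I J f p w⟫_ℝ
      = (1 / 2 : ℝ) * (dl v * ⟪Y p, w⟫_ℝ + dl (Y p) * ⟪v, w⟫_ℝ - dl w * ⟪v, Y p⟫_ℝ) := by
  have hmd : ∀ q, MDifferentiableAt I J f q := fun q =>
    hf.contMDiff.mdifferentiableAt (by simp)
  have hl := differentiableAt_comp_chart hdil
  have hp := mem_chart_source H p
  have hFx : mapInChart I J f p (extChartAt I p p) = extChartAt J (f p) (f p) := mapInChart_self p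
  have hDF := fun u => tangentCoord_mfderiv_self (hmd p) u
  have hc := tangentCoordSymm_tangentCoord (I := I) hp
  have heq : ∀ u, ∀ w ∈ horizontalSpace I J f p,
      metricInChart J (f p) (mapInChart I J f p (extChartAt I p p))
        (fderiv ℝ (mapInChart I J f p) (extChartAt I p p) u)
        (fderiv ℝ (mapInChart I J f p) (extChartAt I p p) (tangentCoord I p p w))
      = dil p ^ 2 * metricInChart I p (extChartAt I p p) u (tangentCoord I p p w) := by
    intro u w hw
    obtain ⟨u, rfl⟩ : ∃ u', u = tangentCoord I p p u' :=
      ⟨tangentCoordSymm I p p u, (tangentCoord_tangentCoordSymm hp u).symm⟩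
    rw [← hDF, ← hDF, hFx, metricInChart_self, metricInChart_self, hf.inner_mfderiv _ hw]
  have key := christoffel_pullback (F := mapInChart I J f p) (G := metricInChart I p)
    (K := metricInChart J (f p)) (l := fun z => dil ((extChartAt I p).symm z) ^ 2)
    (S := (horizontalSpace I J f p).comap (tangentCoordSymm I p p).toLinearMap)
    ((contDiffAt_mapInChart (hf.contMDiff p)).of_le (by norm_cast))
    (differentiableAt_metricInChart p) (hFx ▸ differentiableAt_metricInChart (f p)) hl
    (Eventually.of_forall fun z => metricInChart_comm p z) (metricInChart_comm (f p))
    (by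
      filter_upwards [eventually_chart (I := I) p, eventually_map_chart (I := I) (H' := H')
        (hf.contMDiff.continuous.continuousAt (x := p))] with z hz hfz a
      have hsymm : (extChartAt J (f p)).symm (mapInChart I J f p z)
          = f ((extChartAt I p).symm z) :=
        (extChartAt J (f p)).left_inv (by simpa using hfz)
      rw [← tangentCoord_mfderiv hz.1 hz.2 hfz (hmd _), metricInChart_apply, metricInChart_apply,
        hsymm, tangentCoordSymm_tangentCoord hfz]
      exact hf.inner_mfderiv_self_le _)
    (by
      intro a ha
      have := heq a (tangentCoordSymm I p p a) ha
      rw [tangentCoord_tangentCoordSymm hp] at this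
      rw [extChartAt_to_inv]
      exact this)
    (a := tangentCoord I p p v) (b := tangentCoord I p p (Y p)) (c := tangentCoord I p p w)
    (by simpa [hc] using hv) (by simpa [hc] using hYh) (by simpa [hc] using hw)
  simp only [metricInChart_self] at key
  rw [extChartAt_to_inv] at key
  rw [mvfderiv_eq_fderiv hl, mvfderiv_eq_fderiv hl, mvfderiv_eq_fderiv hl, secondFundamentalForm,
    inner_sub_left, inner_pullbackCovDeriv hf.contMDiff hY, hf.inner_mfderiv _ hw,
    inner_leviCivita hY, hDF, map_add, add_apply, heq _ w hw]
  linarith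

end Conformal

section AlmostContact

variable {E : Type*} [NormedAddCommGroup E] [NormedSpace ℝ E] [FiniteDimensional ℝ E]
  {H : Type*} [TopologicalSpace H] {I : ModelWithCorners ℝ E H}
  {M : Type*} [TopologicalSpace M] [ChartedSpace H M] [IsManifold I ∞ M]
  [RiemannianBundle (fun x : M => TangentSpace I x)]

omit [FiniteDimensional ℝ E] in
theorem AlmostContactMetricStructure.inner_ξ (S : AlmostContactMetricStructure I M) (x : M)
    (v : TangentSpace I x) : ⟪v, S.ξ x⟫_ℝ = S.η x v := by
  have h := S.inner_φ_φ x v (S.ξ x)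
  rw [S.φ_ξ, inner_zero_right, S.η_ξ] at h
  linarith

end AlmostContact

section Submersion

variable {E : Type*} [NormedAddCommGroup E] [NormedSpace ℝ E] [FiniteDimensional ℝ E]
  {H : Type*} [TopologicalSpace H] {I : ModelWithCorners ℝ E H}
  {M : Type*} [TopologicalSpace M] [ChartedSpace H M] [IsManifold I ∞ M]
  [RiemannianBundle (fun x : M => TangentSpace I x)]
  {E' : Type*} [NormedAddCommGroup E'] [NormedSpace ℝ E'] [FiniteDimensional ℝ E']
  {H' : Type*} [TopologicalSpace H'] {J : ModelWithCorners ℝ E' H'}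
  {N : Type*} [TopologicalSpace N] [ChartedSpace H' N] [IsManifold J ∞ N]
  [RiemannianBundle (fun y : N => TangentSpace J y)]
  {f : M → N} {dil : M → ℝ}

omit [IsManifold I ∞ M] [FiniteDimensional ℝ E'] [IsManifold J ∞ N]
  [RiemannianBundle (fun y : N => TangentSpace J y)] in
theorem riemannianGradient_mem_verticalSpace_iff (φ : M → ℝ) (p : M) :
    riemannianGradient I φ p ∈ verticalSpace I J f p
      ↔ ∀ w ∈ horizontalSpace I J f p, mvfderiv I φ p w = 0 := by
  have hgrad : ∀ w, ⟪riemannianGradient I φ p, w⟫_ℝ = mvfderiv I φ p w := by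
    intro w
    have : CompleteSpace (TangentSpace I p) := FiniteDimensional.complete ℝ _
    exact InnerProductSpace.toDual_symm_apply
  rw [← (verticalSpace I J f p).orthogonal_orthogonal, Submodule.mem_orthogonal]
  exact forall₂_congr fun w _ => by rw [real_inner_comm, hgrad]

/-- The squared dilation of a horizontally conformal submersion is differentiable as soon as there
is a horizontal vector field of unit length. -/
theorem IsHorizontallyConformalSubmersion.mdifferentiableAt_dil_sq
    [I.Boundaryless] [J.Boundaryless]
    [IsContMDiffRiemannianBundle J ∞ E' (fun y : N => TangentSpace J y)]
    (hf : IsHorizontallyConformalSubmersion I J f dil) {Y : Π x : M, TangentSpace I x}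
    (p : M) (hY : MDifferentiableAt I I.tangent (fun x => (⟨x, Y x⟩ : TangentBundle I M)) p)
    (hYh : ∀ x, Y x ∈ horizontalSpace I J f x) (hY1 : ∀ x, ⟪Y x, Y x⟫_ℝ = 1) :
    MDifferentiableAt I 𝓘(ℝ, ℝ) (fun q => dil q ^ 2) p := by
  have hdil : ∀ q, dil q ^ 2 = ⟪mfderiv I J f q (Y q), mfderiv I J f q (Y q)⟫_ℝ := fun q => by
    rw [← hf.conformal q _ (hYh q) _ (hYh q), hY1, mul_one]
  have hF := contDiffAt_mapInChart (hf.contMDiff p)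
  have hσ := (((hF.fderiv_right (m := 1) (by norm_cast)).differentiableAt
    (by norm_num)).hasFDerivAt).clm_apply (differentiableAt_fieldInChart hY).hasFDerivAt
  have hK : DifferentiableAt ℝ (metricInChart J (f p)) (mapInChart I J f p (extChartAt I p p)) :=
    mapInChart_self (I := I) (J := J) (f := f) p ▸ differentiableAt_metricInChart (f p)
  have hKF := HasFDerivAt.comp (g := metricInChart J (f p)) _ hK.hasFDerivAt
    (hF.differentiableAt (by simp)).hasFDerivAt
  refine mdifferentiableAt_of_comp_chart
    (((hKF.clm_apply hσ).clm_apply hσ).differentiableAt.congr_of_eventuallyEq ?_)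
  filter_upwards [tangentCoord_mfderiv_field hf.contMDiff Y,
    eventually_map_chart (I := I) (H' := H') (hf.contMDiff.continuous.continuousAt (x := p))]
    with z hz hfz
  have hsymm : (extChartAt J (f p)).symm (mapInChart I J f p z) = f ((extChartAt I p).symm z) :=
    (extChartAt J (f p)).left_inv (by simpa using hfz)
  rw [hdil, Function.comp_apply, ← hz, metricInChart_apply, hsymm,
    tangentCoordSymm_tangentCoord hfz]

omit [IsManifold I ∞ M] [FiniteDimensional ℝ E'] [IsManifold J ∞ N] in
/-- A tangent vector of `N` is zero iff it is orthogonal to the images of all horizontal vectors. -/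
theorem IsHorizontallyConformalSubmersion.eq_zero_iff
    (hf : IsHorizontallyConformalSubmersion I J f dil) {p : M} (n : TangentSpace J (f p)) :
    n = 0 ↔ ∀ w ∈ horizontalSpace I J f p, ⟪n, mfderiv I J f p w⟫_ℝ = 0 := by
  refine ⟨fun h w _ => by rw [h, inner_zero_left], fun h => ?_⟩
  obtain ⟨v, rfl⟩ := hf.surjective_mfderiv p n
  obtain ⟨w, hw, -, -, -, hv⟩ := exists_horizontal_add_vertical (J := J) (f := f) p v
  have := h w hw
  rwa [← hv, inner_self_eq_zero] at this

end Submersion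

end XiPerp

open XiPerp
theorem mainTheorem8
    {E : Type*} [NormedAddCommGroup E] [NormedSpace ℝ E] [FiniteDimensional ℝ E]
    {H : Type*} [TopologicalSpace H] (I : ModelWithCorners ℝ E H) [I.Boundaryless]
    {M : Type*} [TopologicalSpace M] [T2Space M] [ChartedSpace H M] [IsManifold I ∞ M]
    [RiemannianBundle (fun x : M => TangentSpace I x)]
    [IsContMDiffRiemannianBundle I ∞ E (fun x : M => TangentSpace I x)]
    {E' : Type*} [NormedAddCommGroup E'] [NormedSpace ℝ E'] [FiniteDimensional ℝ E']
    {H' : Type*} [TopologicalSpace H'] (J : ModelWithCorners ℝ E' H') [J.Boundaryless]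
    {N : Type*} [TopologicalSpace N] [T2Space N] [ChartedSpace H' N] [IsManifold J ∞ N]
    [RiemannianBundle (fun y : N => TangentSpace J y)]
    [IsContMDiffRiemannianBundle J ∞ E' (fun y : N => TangentSpace J y)]
    (S : AlmostContactMetricStructure I M) (hS : S.IsSasakian)
    (f : M → N) (dil : M → ℝ)
    (hf : IsConformalAntiInvariantXiPerpSubmersion I J f S dil)
    (hker : ∀ p, verticalSpace I J f p ≠ ⊥)
    (hsplit : HorizontalEqPhiVerticalOplusXi I J f S) :
    IsPhiKerMuTotallyGeodesic I J f S ↔ IsHorizontallyHomothetic I J f dil := by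
  have hc := hf.toIsHorizontallyConformalSubmersion
  have hξ : ∀ p, MDifferentiableAt I I.tangent (fun x => (⟨x, S.ξ x⟩ : TangentBundle I M)) p :=
    fun p => S.smooth_ξ.mdifferentiableAt (by simp)
  have hξ1 : ∀ x, ⟪S.ξ x, S.ξ x⟫_ℝ = 1 := fun x => by rw [S.inner_ξ, S.η_ξ]
  have hsq : ∀ p, MDifferentiableAt I 𝓘(ℝ, ℝ) (fun q => dil q ^ 2) p := fun p =>
    hc.mdifferentiableAt_dil_sq p (hξ p) hf.ξ_horizontal hξ1
  have hII : ∀ p, ∀ u ∈ verticalSpace I J f p, ∀ w ∈ horizontalSpace I J f p,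
      ⟪secondFundamentalForm I J f p (S.φ p u) S.ξ, mfderiv I J f p w⟫_ℝ
        = (1 / 2 : ℝ) * (mvfderiv I (fun q => dil q ^ 2) p (S.φ p u) * ⟪S.ξ p, w⟫_ℝ
          + mvfderiv I (fun q => dil q ^ 2) p (S.ξ p) * ⟪S.φ p u, w⟫_ℝ) := by
    intro p u hu w hw
    rw [hc.inner_secondFundamentalForm (hsq p) (hξ p) (hf.ξ_horizontal p)
      (hf.anti_invariant p u hu) hw, S.inner_ξ p (S.φ p u), S.η_φ]
    ring
  have hφ : ∀ p, ∀ u ∈ verticalSpace I J f p, ⟪S.φ p u, S.φ p u⟫_ℝ = ⟪u, u⟫_ℝ := by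
    intro p u hu
    rw [S.inner_φ_φ, ← S.inner_ξ, Submodule.inner_right_of_mem_orthogonal hu (hf.ξ_horizontal p)]
    ring
  have hdil : ∀ p, MDifferentiableAt I 𝓘(ℝ, ℝ) dil p := by
    intro p
    have h := differentiableAt_comp_chart (hsq p)
    refine mdifferentiableAt_of_comp_chart ((h.sqrt (pow_pos (hc.dil_pos _) 2).ne').congr_of_eventuallyEq
      (Filter.Eventually.of_forall fun z => (Real.sqrt_sq (hc.dil_pos _).le).symm))
  have hdsq : ∀ p w, mvfderiv I (fun q => dil q ^ 2) p w = 2 * dil p * mvfderiv I dil p w := by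
    intro p w
    have h := differentiableAt_comp_chart (hdil p)
    rw [mvfderiv_eq_fderiv h, mvfderiv_eq_fderiv (differentiableAt_comp_chart (hsq p)),
      (h.hasFDerivAt.pow 2).fderiv]
    simp
  have hdsq0 : ∀ p w, mvfderiv I (fun q => dil q ^ 2) p w = 0 ↔ mvfderiv I dil p w = 0 := by
    intro p w
    rw [hdsq, mul_eq_zero, or_iff_right (mul_pos two_pos (hc.dil_pos p)).ne']
  constructor
  · intro hT p
    refine ⟨hdil p, (riemannianGradient_mem_verticalSpace_iff dil p).2 fun w hw => ?_⟩
    rw [← hdsq0]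
    have h0 : ∀ u ∈ verticalSpace I J f p, ∀ w ∈ horizontalSpace I J f p,
        mvfderiv I (fun q => dil q ^ 2) p (S.φ p u) * ⟪S.ξ p, w⟫_ℝ
          + mvfderiv I (fun q => dil q ^ 2) p (S.ξ p) * ⟪S.φ p u, w⟫_ℝ = 0 := by
      intro u hu w hw
      have := hII p u hu w hw
      rw [hT p u hu, inner_zero_left] at this
      linarith
    have hφu : ∀ u ∈ verticalSpace I J f p,
        mvfderiv I (fun q => dil q ^ 2) p (S.φ p u) = 0 := by
      intro u hu
      have := h0 u hu _ (hf.ξ_horizontal p)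
      rwa [hξ1, S.inner_ξ, S.η_φ, mul_one, mul_zero, add_zero] at this
    have hξ0 : mvfderiv I (fun q => dil q ^ 2) p (S.ξ p) = 0 := by
      obtain ⟨u, hu, hu0⟩ := (verticalSpace I J f p).exists_mem_ne_zero_of_ne_bot (hker p)
      have := h0 u hu _ (hf.anti_invariant p u hu)
      rw [hφu u hu, zero_mul, zero_add, hφ p u hu] at this
      exact (mul_eq_zero.1 this).resolve_right (inner_self_ne_zero.2 hu0)
    rw [(hsplit p).1] at hw
    obtain ⟨_, ⟨u, hu, rfl⟩, _, hx, rfl⟩ := Submodule.mem_sup.1 hw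
    obtain ⟨t, rfl⟩ := Submodule.mem_span_singleton.1 hx
    rw [map_add, map_smul, hξ0, smul_zero, add_zero]
    exact hφu u hu
  · intro hh p u hu
    have hv := fun w hw => (hdsq0 p w).2
      ((riemannianGradient_mem_verticalSpace_iff dil p).1 (hh p).2 w hw)
    refine (hc.eq_zero_iff _).2 fun w hw => ?_
    rw [hII p u hu w hw, hv _ (hf.anti_invariant p u hu), hv _ (hf.ξ_horizontal p)]
    ring
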